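/- Let $n_1,n_2,n_3,n_4\ge 0$ be integers with $n_1\ge 1$ or $n_3\ge 1$, and let real parameters be given with $$a_j>0,\ b_j\ge 0\ (1\le j\le n_1);\qquad a'_j>0,\ c_j\ge 0,\ d_j\ge c_j+1\ (1\le j\le n_2);$$ $$a''_j>0,\ r_j>0,\ o_j\ge 0\ (1\le j\le n_3);\qquad a'''_j>0,\ v_j>0,\ w_j\ge v_j+1\ (1\le j\le n_4).$$ Put $m'=n_1+n_2+n_3$, $n'=n_3+n_4$, $p'=n_2+n_3+n_4$, $q'=n_1+n_2+n_3+n_4$, and $$(\alpha'_j,A'_j)_1^{p'}=(1-r_j,a''_j)_1^{n_3},\,(1-v_j,a'''_j)_1^{n_4},\,(d_j,a'_j)_1^{n_2},$$ $$(\beta'_j,B'_j)_1^{q'}=(b_j,a_j)_1^{n_1},\,(c_j,a'_j)_1^{n_2},\,(o_j,a''_j)_1^{n_3},\,(1-w_j,a'''_j)_1^{n_4}.$$ Assume that $A'_j(\beta'_{k}+l)\ne B'_{k}(\alpha'_j-l'-1)$ for all $1\le j\le n'$, $1\le k\le m'$ and integers $l,l'\ge 0$. Then the Fox $H$-function $$H^{m',n'}_{p',q'}(t)=\frac1{2\pi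 i}\int_{\gamma-i\infty}^{\gamma+i\infty} \frac{\prod_{j=1}^{m'}\Gamma(\beta'_j+B'_js)\prod_{j=1}^{n'}\Gamma(1-\alpha'_j-A'_js)} {\prod_{j=m'+1}^{q'}\Gamma(1-\beta'_j-B'_js)\prod_{j=n'+1}^{p'}\Gamma(\alpha'_j+A'_js)}\,t^{-s}\,ds,$$ where the line $\Re s=\gamma$ has all poles of the functions $\Gamma(\beta'_j+B'_js)$, $j\le m'$, on its left and all poles of the functions $\Gamma(1-\alpha'_j-A'_js)$, $j\le n'$, on its right, exists on $(0,\infty)$ (such lines exist, and for every $t>0$ the integral converges absolutely along each of them, with the same value), and it is real and strictly positive: $H^{m',n'}_{p',q'}(t)>0$ for every $t>0$. -/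

import Mathlib

open MeasureTheory

noncomputable section

/-- The Mellin-Barnes kernel `Ξ^{m,n}_{p,q}(s)`. The upper parameters `(α_1, A_1), …, (α_p, A_p)` and
the lower parameters `(β_1, B_1), …, (β_q, B_q)` are given as lists of pairs, so that `p` and `q` are
the lengths of the lists:
`∏_{j ≤ m} Γ(β_j + B_j s) ∏_{j ≤ n} Γ(1 - α_j - A_j s)`
divided by `∏_{m < j ≤ q} Γ(1 - β_j - B_j s) ∏_{n < j ≤ p} Γ(α_j + A_j s)`. -/
def foxXi (m n : ℕ) (upper lower : List (ℂ × ℝ)) (s : ℂ) : ℂ :=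
  (((lower.take m).map fun x => Complex.Gamma (x.1 + x.2 * s)).prod *
      ((upper.take n).map fun x => Complex.Gamma (1 - x.1 - x.2 * s)).prod) /
    (((lower.drop m).map fun x => Complex.Gamma (1 - x.1 - x.2 * s)).prod *
      ((upper.drop n).map fun x => Complex.Gamma (x.1 + x.2 * s)).prod)

/-- The integrand of the Mellin-Barnes integral at the point `s`: `Ξ(s) z^{-s}`. -/
def foxIntegrand (m n : ℕ) (upper lower : List (ℂ × ℝ)) (z s : ℂ) : ℂ :=
  foxXi m n upper lower s * z ^ (-s)

/-- The poles of `Γ(β_j + B_j s)`, `j ≤ m`, differ from the poles of `Γ(1 - α_i - A_i s)`, `i ≤ n`: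
`A_i (β_j + l) ≠ B_j (α_i - l' - 1)` for all natural numbers `l`, `l'`. -/
def FoxPolesDisjoint (m n : ℕ) (upper lower : List (ℂ × ℝ)) : Prop :=
  ∀ x ∈ upper.take n, ∀ y ∈ lower.take m, ∀ l l' : ℕ,
    (x.2 : ℂ) * (y.1 + l) ≠ (y.2 : ℂ) * (x.1 - l' - 1)

/-- The vertical line `Re s = γ` separates the poles `-(β_j + l) / B_j` of the functions
`Γ(β_j + B_j s)`, `j ≤ m`, which lie to its left, from the poles `(1 - α_i + l) / A_i` of the functions
`Γ(1 - α_i - A_i s)`, `i ≤ n`, which lie to its right. -/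
def FoxSeparates (m n : ℕ) (upper lower : List (ℂ × ℝ)) (γ : ℝ) : Prop :=
  (∀ y ∈ lower.take m, ∀ l : ℕ, (-(y.1 + l) / (y.2 : ℂ)).re < γ) ∧
    ∀ x ∈ upper.take n, ∀ l : ℕ, γ < ((1 - x.1 + l) / (x.2 : ℂ)).re

/-- The Mellin-Barnes integral of the integrand along the line from `γ - i∞` to `γ + i∞` converges
absolutely. -/
def FoxHConverges (m n : ℕ) (upper lower : List (ℂ × ℝ)) (γ : ℝ) (z : ℂ) : Prop :=
  Integrable fun y : ℝ => foxIntegrand m n upper lower z (γ + y * Complex.I)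

/-- The Fox H-function as the Mellin-Barnes integral `(2πi)⁻¹ ∫ Ξ(s) z^{-s} ds` along the line from
`γ - i∞` to `γ + i∞`, that is `s = γ + i y`, `ds = i dy`; to be used for a line that separates the
two families of poles and along which the integral converges. -/
def foxH (m n : ℕ) (upper lower : List (ℂ × ℝ)) (γ : ℝ) (z : ℂ) : ℂ :=
  (2 * (Real.pi : ℂ) * Complex.I)⁻¹ *
    ∫ y : ℝ, foxIntegrand m n upper lower z (γ + y * Complex.I) * Complex.I

/-- The list of pairs `(x_1, X_1), …, (x_k, X_k)`. -/
def pairList {k : ℕ} (x X : Fin k → ℝ) : List (ℂ × ℝ) :=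
  List.ofFn fun j => ((x j : ℂ), X j)

/-- The `n₂ + n₃ + n₄` upper parameters, in the order
`(1 - r_j, a₃_j)`, `(1 - v_j, a₄_j)`, `(d_j, a₂_j)`. -/
def epUpper {n₂ n₃ n₄ : ℕ} (a₂ d : Fin n₂ → ℝ) (a₃ r : Fin n₃ → ℝ) (a₄ v : Fin n₄ → ℝ) :
    List (ℂ × ℝ) :=
  pairList (fun j => 1 - r j) a₃ ++ pairList (fun j => 1 - v j) a₄ ++ pairList d a₂

/-- The `n₁ + n₂ + n₃ + n₄` lower parameters, in the order
`(b_j, a₁_j)`, `(c_j, a₂_j)`, `(o_j, a₃_j)`, `(1 - w_j, a₄_j)`. -/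
def epLower {n₁ n₂ n₃ n₄ : ℕ} (a₁ b : Fin n₁ → ℝ) (a₂ c : Fin n₂ → ℝ) (a₃ o : Fin n₃ → ℝ)
    (a₄ w : Fin n₄ → ℝ) : List (ℂ × ℝ) :=
  pairList b a₁ ++ pairList c a₂ ++ pairList o a₃ ++ pairList (fun j => 1 - w j) a₄

end

/-! The proof uses only positivity and Fubini. Since the parameters come in matching pairs, the
kernel is a product of factors `Γ(b + k s)` and quotients `Γ(c + k s) / Γ(d + k s)` with `c < d`.
Each is a Mellin transform at an affine point, of `e^{-x}` or of a beta density on `(0, 1)`. If `Ξ`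
has positive inverse `h` and `M s` is the Mellin transform of `w` at `b + k s`, then `Ξ M` has
inverse `t ↦ ∫ w(x) x^{b-1} h(t x^{-k}) dx`, again positive (`HasPosMellinInverse.mul`). The
induction starts from one factor `Γ(b + a s)` with `a > 0`, available as `n₁ ≥ 1` or `n₃ ≥ 1`, whose
inverse is `a⁻¹ t^{b/a} exp(-t^{1/a})` (`hasPosMellinInverse_Gamma`). The inverse is built without
reference to the line, so all separating lines give the same value and no contour is shifted. -/

noncomputable section

/-- `Ξ` is the Mellin transform of a positive function, recovered by the inversion integral along
every vertical line with abscissa in `S`. -/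
def HasPosMellinInverse (S : Set ℝ) (Ξ : ℂ → ℂ) : Prop :=
  ∃ h : ℝ → ℝ, ∀ t : ℝ, 0 < t → 0 < h t ∧ ∀ γ ∈ S,
    Integrable (fun y : ℝ => Ξ (γ + y * Complex.I) * (t : ℂ) ^ (-(γ + y * Complex.I : ℂ))) ∧
    ∫ y : ℝ, Ξ (γ + y * Complex.I) * (t : ℂ) ^ (-(γ + y * Complex.I : ℂ)) =
      2 * Real.pi * (h t : ℂ)

/-- On the vertical lines with abscissa in `S`, `M s` is the Mellin transform at `b + k s` of a
nonnegative function that is positive on `(0, 1)`. -/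
def IsPosMellinTransform (S : Set ℝ) (M : ℂ → ℂ) : Prop :=
  ∃ (w : ℝ → ℝ) (b k : ℝ), (∀ x, 0 < x → 0 ≤ w x) ∧ (∀ x ∈ Set.Ioo (0 : ℝ) 1, 0 < w x) ∧
    ∀ s : ℂ, s.re ∈ S → HasMellin (fun x => (w x : ℂ)) (b + k * s) (M s)

/-! ### Multiplicative convolution of positive functions -/

theorem cpow_mul_cpow_shift {t x : ℝ} (ht : 0 < t) (hx : 0 < x) (b k : ℝ) (s : ℂ) :
    (t : ℂ) ^ (-s) * (x : ℂ) ^ (b + k * s - 1) =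
      ((x ^ (b - 1) : ℝ) : ℂ) * ((t * x ^ (-k) : ℝ) : ℂ) ^ (-s) := by
  have hx' : (x : ℂ) ≠ 0 := by exact_mod_cast hx.ne'
  have ht' : (t : ℂ) ≠ 0 := by exact_mod_cast ht.ne'
  have hy : (0 : ℝ) < x ^ (-k) := Real.rpow_pos_of_pos hx _
  rw [Complex.ofReal_mul, Complex.mul_cpow_ofReal_nonneg ht.le hy.le,
    Complex.ofReal_cpow hx.le, Complex.ofReal_cpow hx.le,
    Complex.cpow_def_of_ne_zero hx', Complex.cpow_def_of_ne_zero hx',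
    Complex.cpow_def_of_ne_zero hx', Complex.cpow_def_of_ne_zero (Complex.exp_ne_zero _),
    ← Complex.ofReal_log hx.le]
  have : Complex.log (Complex.exp ((Real.log x : ℂ) * ((-k : ℝ) : ℂ))) =
      (Real.log x : ℂ) * ((-k : ℝ) : ℂ) := by
    apply Complex.log_exp <;> simp [Real.pi_pos, Real.pi_pos.le]
  rw [this, mul_left_comm, ← Complex.exp_add]
  congr 2
  push_cast
  ring

/-- Insert the Mellin integral of `M` and integrate over the line first: `x^{k s}` merges with
`t^{-s}` into `(t x^{-k})^{-s}`, so the inner integral is the inversion formula of `Ξ` at `t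
x^{-k}`. -/
theorem HasPosMellinInverse.mul {S : Set ℝ} (hS : S.Nonempty) {Ξ M : ℂ → ℂ}
    (hΞ : HasPosMellinInverse S Ξ) (hM : IsPosMellinTransform S M) :
    HasPosMellinInverse S (fun s => Ξ s * M s) := by
  obtain ⟨h, hh⟩ := hΞ
  obtain ⟨w, b, k, hw0, hw1, hMw⟩ := hM
  let G : ℝ → ℝ → ℝ := fun t x => w x * x ^ (b - 1) * h (t * x ^ (-k))
  have key : ∀ t : ℝ, 0 < t → ∀ γ ∈ S,
      Integrable (fun z : ℝ × ℝ => Ξ (γ + z.1 * Complex.I) *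
          (t : ℂ) ^ (-(γ + z.1 * Complex.I : ℂ)) *
          ((z.2 : ℂ) ^ (b + k * (γ + z.1 * Complex.I) - 1 : ℂ) * (w z.2 : ℂ)))
        (volume.prod (volume.restrict (Set.Ioi 0))) := by
    intro t ht γ hγ
    have h1 := ((hh t ht).2 γ hγ).1
    have h2 := (hMw γ (by simpa using hγ)).1
    have h3 := h1.mul_prod h2
    have h4 : AEStronglyMeasurable
        (fun z : ℝ × ℝ => Complex.exp ((k * z.1 * Real.log z.2 : ℝ) * Complex.I))
        (volume.prod (volume.restrict (Set.Ioi 0))) := by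
      apply Measurable.aestronglyMeasurable
      fun_prop
    have h5 := h3.bdd_mul (c := 1) h4 (by
      filter_upwards with z
      rw [Complex.norm_exp_ofReal_mul_I])
    refine h5.congr ?_
    have hpos : ∀ᵐ z : ℝ × ℝ ∂(volume.prod (volume.restrict (Set.Ioi 0))), 0 < z.2 :=
      Measure.quasiMeasurePreserving_snd.ae
        ((ae_restrict_iff' measurableSet_Ioi).2 (Filter.Eventually.of_forall fun x hx => hx))
    filter_upwards [hpos] with z hz
    have hz' : (z.2 : ℂ) ≠ 0 := by exact_mod_cast hz.ne'
    simp only [smul_eq_mul]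
    have e : (b + k * (γ + z.1 * Complex.I) - 1 : ℂ) =
        (b + k * γ - 1 : ℂ) + k * z.1 * Complex.I := by ring
    rw [e, Complex.cpow_add _ _ hz', Complex.cpow_def_of_ne_zero hz' (k * z.1 * Complex.I),
      ← Complex.ofReal_log hz.le]
    have e2 : (Real.log z.2 : ℂ) * (k * z.1 * Complex.I) =
      ((k * z.1 * Real.log z.2 : ℝ) : ℂ) * Complex.I := by push_cast; ring
    rw [e2]
    ring
  have inner : ∀ t : ℝ, 0 < t → ∀ γ ∈ S, ∀ x : ℝ, 0 < x →
      ∫ y : ℝ, Ξ (γ + y * Complex.I) * (t : ℂ) ^ (-(γ + y * Complex.I : ℂ)) *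
          ((x : ℂ) ^ (b + k * (γ + y * Complex.I) - 1 : ℂ) * (w x : ℂ)) =
        2 * Real.pi * (G t x : ℂ) := by
    intro t ht γ hγ x hx
    have h1 := ((hh (t * x ^ (-k)) (mul_pos ht (Real.rpow_pos_of_pos hx _))).2 γ hγ).2
    have : ∀ y : ℝ, Ξ (γ + y * Complex.I) * (t : ℂ) ^ (-(γ + y * Complex.I : ℂ)) *
          ((x : ℂ) ^ (b + k * (γ + y * Complex.I) - 1 : ℂ) * (w x : ℂ)) =
        ((w x * x ^ (b - 1) : ℝ) : ℂ) * (Ξ (γ + y * Complex.I) *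
          ((t * x ^ (-k) : ℝ) : ℂ) ^ (-(γ + y * Complex.I : ℂ))) := by
      intro y
      have := cpow_mul_cpow_shift ht hx b k (γ + y * Complex.I)
      push_cast at this ⊢
      linear_combination (Ξ (γ + y * Complex.I) * w x) * this
    simp_rw [this]
    rw [integral_const_mul, h1]
    simp only [G]
    push_cast
    ring
  have outer : ∀ (t γ y : ℝ), γ ∈ S →
      ∫ x in Set.Ioi (0 : ℝ), Ξ (γ + y * Complex.I) * (t : ℂ) ^ (-(γ + y * Complex.I : ℂ)) *
          ((x : ℂ) ^ (b + k * (γ + y * Complex.I) - 1 : ℂ) * (w x : ℂ)) =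
        Ξ (γ + y * Complex.I) * M (γ + y * Complex.I) *
          (t : ℂ) ^ (-(γ + y * Complex.I : ℂ)) := by
    intro t γ y hγ
    rw [integral_const_mul, ← (hMw (γ + y * Complex.I) (by simpa using hγ)).2]
    simp only [mellin, smul_eq_mul]
    ring
  have swap : ∀ t : ℝ, 0 < t → ∀ γ ∈ S,
      ∫ y : ℝ, Ξ (γ + y * Complex.I) * M (γ + y * Complex.I) *
          (t : ℂ) ^ (-(γ + y * Complex.I : ℂ)) =
        2 * Real.pi * ((∫ x in Set.Ioi (0 : ℝ), G t x : ℝ) : ℂ) := by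
    intro t ht γ hγ
    simp_rw [← outer t γ _ hγ]
    rw [integral_integral_swap (key t ht γ hγ),
      setIntegral_congr_fun measurableSet_Ioi (inner t ht γ hγ), integral_const_mul]
    congr 1
    exact integral_ofReal
  -- Strict positivity of the new integral needs convergence; Fubini on any one line of `S` gives
  -- it, since the inner integral is `2π G t x`.
  have Gint : ∀ t : ℝ, 0 < t → IntegrableOn (G t) (Set.Ioi 0) := by
    intro t ht
    obtain ⟨γ, hγ⟩ := hS
    have h1 := (key t ht γ hγ).integral_prod_right
    have h2 : IntegrableOn (fun x => (2 * Real.pi * G t x : ℂ)) (Set.Ioi 0) :=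
      IntegrableOn.congr_fun h1 (inner t ht γ hγ) measurableSet_Ioi
    have h3 : IntegrableOn (fun x => (2 * Real.pi * G t x : ℝ)) (Set.Ioi 0) := by
      have := h2.re
      refine this.congr (Filter.Eventually.of_forall fun x => ?_)
      have : (2 * Real.pi * G t x : ℂ) = ((2 * Real.pi * G t x : ℝ) : ℂ) := by push_cast; ring
      simp only [this]
      exact Complex.ofReal_re _
    have h4 := h3.const_mul (2 * Real.pi)⁻¹
    refine h4.congr (Filter.Eventually.of_forall fun x => ?_)
    have := Real.pi_ne_zero
    simp only
    field_simp
  refine ⟨fun t => ∫ x in Set.Ioi (0 : ℝ), G t x, fun t ht => ⟨?_, fun γ hγ => ⟨?_, swap t ht γ hγ⟩⟩⟩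
  · have hpos : ∀ x : ℝ, 0 < x → 0 < x ^ (b - 1) * h (t * x ^ (-k)) := fun x hx =>
      mul_pos (Real.rpow_pos_of_pos hx _)
        (hh _ (mul_pos ht (Real.rpow_pos_of_pos hx _))).1
    have hnn : ∀ x ∈ Set.Ioi (0 : ℝ), 0 ≤ G t x := fun x hx => by
      simp only [G, mul_assoc]
      exact mul_nonneg (hw0 x hx) (hpos x hx).le
    rw [setIntegral_pos_iff_support_of_nonneg_ae
      ((ae_restrict_iff' measurableSet_Ioi).2 (Filter.Eventually.of_forall hnn)) (Gint t ht)]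
    -- The weight may vanish beyond `1`, as a beta density does, but the support contains `(0, 1)`.
    refine lt_of_lt_of_le (b := volume (Set.Ioo (0 : ℝ) 1)) (by simp) (measure_mono ?_)
    intro x hx
    refine ⟨?_, hx.1⟩
    have : 0 < G t x := by
      simp only [G, mul_assoc]
      exact mul_pos (hw1 x hx) (hpos x hx.1)
    exact this.ne'
  · refine ((key t ht γ hγ).integral_prod_left).congr (Filter.Eventually.of_forall fun y => ?_)
    exact outer t γ y hγ

theorem HasPosMellinInverse.mul_prod {S : Set ℝ} (hS : S.Nonempty) {ι : Type*} (I : Finset ι)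
    {Ξ : ℂ → ℂ} {M : ι → ℂ → ℂ} (hΞ : HasPosMellinInverse S Ξ)
    (hM : ∀ i ∈ I, IsPosMellinTransform S (M i)) :
    HasPosMellinInverse S (fun s => Ξ s * ∏ i ∈ I, M i s) := by
  classical
  induction I using Finset.induction_on with
  | empty => simpa using hΞ
  | insert i I hi ih =>
    have := (ih fun j hj => hM j (Finset.mem_insert_of_mem hj)).mul hS
      (hM i (Finset.mem_insert_self i I))
    refine cast (congrArg _ (funext fun s => ?_)) this
    rw [Finset.prod_insert hi]
    ring

/-! ### Gamma and beta factors as Mellin transforms -/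

theorem hasMellin_exp_neg {s : ℂ} (hs : 0 < s.re) :
    HasMellin (fun x : ℝ => ((Real.exp (-x) : ℝ) : ℂ)) s (Complex.Gamma s) := by
  constructor
  · have := Complex.GammaIntegral_convergent hs
    refine this.congr_fun (fun x _ => ?_) measurableSet_Ioi
    simp [mul_comm]
  · rw [Complex.Gamma_eq_integral hs, Complex.GammaIntegral_eq_mellin]

theorem isPosMellinTransform_Gamma {S : Set ℝ} {b k : ℝ} (hS : ∀ γ ∈ S, 0 < b + k * γ) :
    IsPosMellinTransform S (fun s => Complex.Gamma (b + k * s)) :=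
  ⟨fun x => Real.exp (-x), b, k, fun x _ => (Real.exp_pos _).le, fun x _ => Real.exp_pos _,
    fun s hs => hasMellin_exp_neg (by simpa using hS _ hs)⟩

/-- This is Euler's beta integral `B(u, e) = Γ(u) Γ(e) / Γ(u + e)`, with `Γ(e)` moved into the
density. -/
theorem hasMellin_beta {u : ℂ} {e : ℝ} (hu : 0 < u.re) (he : 0 < e) :
    HasMellin (fun x : ℝ =>
        (((Set.Ioo (0 : ℝ) 1).indicator (fun x => (1 - x) ^ (e - 1) / Real.Gamma e) x : ℝ) : ℂ))
      u (Complex.Gamma u / Complex.Gamma (u + e)) := by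
  have hv : 0 < (e : ℂ).re := by simpa using he
  have hG : Complex.Gamma e ≠ 0 := Complex.Gamma_ne_zero_of_re_pos hv
  have hGu : Complex.Gamma (u + e) ≠ 0 :=
    Complex.Gamma_ne_zero_of_re_pos (by simpa using add_pos hu he)
  have hfun : Set.EqOn (fun x : ℝ => (x : ℂ) ^ (u - 1) •
        (((Set.Ioo (0 : ℝ) 1).indicator (fun x => (1 - x) ^ (e - 1) / Real.Gamma e) x : ℝ) : ℂ))
      ((Set.Ioo (0 : ℝ) 1).indicator fun x : ℝ =>
        ((x : ℂ) ^ (u - 1) * (1 - (x : ℂ)) ^ ((e : ℂ) - 1)) / Complex.Gamma e) (Set.Ioi 0) := by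
    intro x _
    by_cases hx : x ∈ Set.Ioo (0 : ℝ) 1
    · simp only [Set.indicator_of_mem hx, smul_eq_mul]
      rw [Complex.ofReal_div, Complex.ofReal_cpow (by linarith [hx.2]), Complex.Gamma_ofReal]
      push_cast
      ring
    · simp [Set.indicator_of_notMem hx]
  have hint := Complex.betaIntegral_convergent hu hv
  rw [intervalIntegrable_iff_integrableOn_Ioo_of_le zero_le_one] at hint
  constructor
  · refine IntegrableOn.congr_fun ?_ hfun.symm measurableSet_Ioi
    exact ((integrable_indicator_iff measurableSet_Ioo).2
      (Integrable.div_const hint (Complex.Gamma e))).integrableOn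
  · rw [mellin, setIntegral_congr_fun measurableSet_Ioi hfun,
      setIntegral_indicator measurableSet_Ioo,
      Set.inter_eq_self_of_subset_right (fun x hx => hx.1), integral_div,
      ← integral_Ioc_eq_integral_Ioo, ← intervalIntegral.integral_of_le zero_le_one]
    have := Complex.Gamma_mul_Gamma_eq_betaIntegral hu hv
    rw [Complex.betaIntegral] at this
    field_simp
    linear_combination -this

theorem isPosMellinTransform_Gamma_div_Gamma {S : Set ℝ} {c d k : ℝ} (hcd : c < d)
    (hS : ∀ γ ∈ S, 0 < c + k * γ) :
    IsPosMellinTransform S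
      (fun s => Complex.Gamma (c + k * s) / Complex.Gamma (d + k * s)) := by
  have he : 0 < d - c := sub_pos.2 hcd
  refine ⟨(Set.Ioo (0 : ℝ) 1).indicator fun x => (1 - x) ^ (d - c - 1) / Real.Gamma (d - c),
    c, k, fun x _ => ?_, fun x hx => ?_, fun s hs => ?_⟩
  rotate_left 2
  · have := hasMellin_beta (u := c + k * s) (by simpa using hS _ hs) he
    convert this using 3
    push_cast
    ring
  · refine Set.indicator_nonneg (fun x hx => ?_) x
    have := Real.rpow_pos_of_pos (sub_pos.2 hx.2) (d - c - 1)
    have := Real.Gamma_pos_of_pos he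
    positivity
  · rw [Set.indicator_of_mem hx]
    exact div_pos (Real.rpow_pos_of_pos (sub_pos.2 hx.2) _) (Real.Gamma_pos_of_pos he)

/-! ### Mellin inversion for a single Gamma factor -/

theorem norm_Gamma_le {s : ℂ} (hs : 0 < s.re) : ‖Complex.Gamma s‖ ≤ Real.Gamma s.re := by
  rw [Complex.Gamma_eq_integral hs, Complex.GammaIntegral, Real.Gamma_eq_integral hs]
  refine (norm_integral_le_integral_norm _).trans (le_of_eq ?_)
  refine setIntegral_congr_fun measurableSet_Ioi fun x hx => ?_
  simp only [norm_mul, Complex.norm_real, Complex.norm_cpow_eq_rpow_re_of_pos hx]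
  simp [abs_of_pos (Real.exp_pos _)]

/-- Quadratic decay is enough: from `Γ(s + 2) = (s + 1) s Γ(s)`, `|s + 1| ≥ |s|` and `|Γ(s + 2)| ≤
Γ(σ + 2)` one gets `|Γ(s)| ≤ Γ(σ + 2) / (σ² + y²)`. -/
theorem integrable_Gamma_vertical {σ : ℝ} (hσ : 0 < σ) :
    Integrable fun y : ℝ => Complex.Gamma (σ + y * Complex.I) := by
  have hre : ∀ y : ℝ, (σ + y * Complex.I : ℂ).re = σ := fun y => by simp
  have hcont : Continuous fun y : ℝ => Complex.Gamma (σ + y * Complex.I) := by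
    rw [continuous_iff_continuousAt]
    intro y
    have h1 : ContinuousAt Complex.Gamma (σ + y * Complex.I) := by
      refine (Complex.differentiableAt_Gamma _ fun m hm => ?_).continuousAt
      have := congrArg Complex.re hm
      rw [hre] at this
      simp at this
      have : (0 : ℝ) ≤ m := Nat.cast_nonneg m
      linarith
    exact ContinuousAt.comp (f := fun y : ℝ => (σ + y * Complex.I : ℂ)) h1 (by fun_prop)
  have hdom : Integrable fun y : ℝ => (Real.Gamma (σ + 2) / σ ^ 2) * (1 + (y / σ) ^ 2)⁻¹ :=
    (integrable_inv_one_add_sq.comp_div hσ.ne').const_mul _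
  refine hdom.mono' hcont.aestronglyMeasurable (Filter.Eventually.of_forall fun y => ?_)
  set s : ℂ := σ + y * Complex.I with hs
  have hs0 : s ≠ 0 := fun h0 => by
    have := hre y; rw [← hs, h0] at this; simp at this; linarith
  have hs1 : s + 1 ≠ 0 := fun h0 => by
    have := congrArg Complex.re h0; simp [hre y, hs] at this; linarith
  have hG : Complex.Gamma (s + 2) = (s + 1) * (s * Complex.Gamma s) := by
    rw [← Complex.Gamma_add_one s hs0, ← Complex.Gamma_add_one (s + 1) hs1]
    congr 1
    ring
  have hb : ‖Complex.Gamma (s + 2)‖ ≤ Real.Gamma (σ + 2) := by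
    have h1 : (s + 2).re = σ + 2 := by simp [hs]
    have := norm_Gamma_le (s := s + 2) (by rw [h1]; linarith)
    rwa [h1] at this
  have hn : ‖s‖ ^ 2 = σ ^ 2 + y ^ 2 := by
    rw [← Complex.normSq_eq_norm_sq, hs, Complex.normSq_add_mul_I]
  have hn1 : ‖s‖ ≤ ‖s + 1‖ := by
    refine le_of_sq_le_sq ?_ (norm_nonneg _)
    have : s + 1 = ((σ + 1 : ℝ) : ℂ) + y * Complex.I := by push_cast; rw [hs]; ring
    rw [hn, this, ← Complex.normSq_eq_norm_sq, Complex.normSq_add_mul_I]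
    nlinarith
  rw [hG, norm_mul, norm_mul] at hb
  have h3 : (σ ^ 2 + y ^ 2) * ‖Complex.Gamma s‖ ≤ Real.Gamma (σ + 2) := by
    refine le_trans ?_ hb
    rw [← hn, pow_two, mul_assoc]
    gcongr
  have hpos : 0 < σ ^ 2 + y ^ 2 := by positivity
  rw [show Real.Gamma (σ + 2) / σ ^ 2 * (1 + (y / σ) ^ 2)⁻¹ = Real.Gamma (σ + 2) / (σ ^ 2 + y ^ 2) by
    field_simp]
  rw [le_div_iff₀ hpos]
  linarith

theorem integral_Gamma_mul_cpow {σ x : ℝ} (hσ : 0 < σ) (hx : 0 < x) :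
    Integrable (fun y : ℝ => (x : ℂ) ^ (-(σ + y * Complex.I : ℂ)) *
      Complex.Gamma (σ + y * Complex.I)) ∧
    ∫ y : ℝ, (x : ℂ) ^ (-(σ + y * Complex.I : ℂ)) * Complex.Gamma (σ + y * Complex.I) =
      2 * Real.pi * (Real.exp (-x) : ℝ) := by
  have hx' : (x : ℂ) ≠ 0 := by exact_mod_cast hx.ne'
  have hmel : ∀ y : ℝ, mellin (fun x : ℝ => ((Real.exp (-x) : ℝ) : ℂ)) (σ + y * Complex.I) =
      Complex.Gamma (σ + y * Complex.I) := fun y => (hasMellin_exp_neg (by simpa using hσ)).2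
  constructor
  · refine (integrable_Gamma_vertical hσ).bdd_mul (c := x ^ (-σ)) ?_ ?_
    · refine Continuous.aestronglyMeasurable ?_
      exact Continuous.const_cpow (by fun_prop) (Or.inl hx')
    · filter_upwards with y
      rw [Complex.norm_cpow_eq_rpow_re_of_pos hx]
      simp
  · have := mellinInv_mellin_eq σ (fun x : ℝ => ((Real.exp (-x) : ℝ) : ℂ)) hx
      (hasMellin_exp_neg (by simpa using hσ)).1
      (by
        refine (integrable_Gamma_vertical hσ).congr (Filter.Eventually.of_forall fun y => ?_)
        exact (hmel y).symm)
      (by fun_prop)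
    rw [mellinInv] at this
    simp_rw [hmel, smul_eq_mul] at this
    rw [← this, Complex.real_smul]
    rw [← mul_assoc]
    push_cast
    rw [mul_one_div_cancel (by simp), one_mul]

/-- With `x = t^{1/a}` one has `t^{-s} = t^{b/a} x^{-(b + a s)}`; the substitution `y ↦ a y` then
reduces to the inversion of `e^{-x}` on the line `b + a γ`, with Jacobian `a⁻¹`. -/
theorem hasPosMellinInverse_Gamma {S : Set ℝ} {a b : ℝ} (ha : 0 < a)
    (hS : ∀ γ ∈ S, 0 < b + a * γ) :
    HasPosMellinInverse S (fun s => Complex.Gamma (b + a * s)) := by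
  refine ⟨fun t => a⁻¹ * t ^ (b / a) * Real.exp (-t ^ a⁻¹), fun t ht => ⟨?_, fun γ hγ => ?_⟩⟩
  · have := Real.rpow_pos_of_pos ht (b / a)
    positivity
  · have hx : 0 < t ^ a⁻¹ := Real.rpow_pos_of_pos ht _
    obtain ⟨h1, h2⟩ := integral_Gamma_mul_cpow (hS γ hγ) hx
    have hfun : ∀ y : ℝ, Complex.Gamma (b + a * (γ + y * Complex.I)) *
          (t : ℂ) ^ (-(γ + y * Complex.I : ℂ)) =
        ((t ^ (b / a) : ℝ) : ℂ) *
          (fun y : ℝ => ((t ^ a⁻¹ : ℝ) : ℂ) ^ (-(((b + a * γ : ℝ) : ℂ) + y * Complex.I)) *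
            Complex.Gamma (((b + a * γ : ℝ) : ℂ) + y * Complex.I)) (a * y) := by
      intro y
      have e1 : ((b + a * γ : ℝ) : ℂ) + ((a * y : ℝ) : ℂ) * Complex.I =
        b + a * (γ + y * Complex.I) := by push_cast; ring
      have ht' : (t : ℂ) ≠ 0 := by exact_mod_cast ht.ne'
      have ha' : (a : ℂ) ≠ 0 := by exact_mod_cast ha.ne'
      have hx' : ((t ^ a⁻¹ : ℝ) : ℂ) ≠ 0 := by exact_mod_cast hx.ne'
      simp only [e1]
      rw [Complex.ofReal_cpow ht.le (b / a), Complex.cpow_def_of_ne_zero hx',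
        Complex.cpow_def_of_ne_zero ht', Complex.cpow_def_of_ne_zero ht',
        ← Complex.ofReal_log hx.le, ← Complex.ofReal_log ht.le, Real.log_rpow ht, ← mul_assoc,
        ← Complex.exp_add, mul_comm]
      congr 2
      push_cast
      field_simp
      ring
    rw [funext hfun]
    refine ⟨(h1.comp_mul_left' ha.ne').const_mul _, ?_⟩
    rw [integral_const_mul, Measure.integral_comp_mul_left (fun y : ℝ =>
        ((t ^ a⁻¹ : ℝ) : ℂ) ^ (-(((b + a * γ : ℝ) : ℂ) + y * Complex.I)) *
          Complex.Gamma (((b + a * γ : ℝ) : ℂ) + y * Complex.I)) a, h2, abs_of_pos (inv_pos.2 ha),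
      Complex.real_smul]
    push_cast
    ring

end

/-! ### Factorisation of the kernel and separating lines -/

theorem prod_map_pairList {k : ℕ} (x X : Fin k → ℝ) (f : ℂ × ℝ → ℂ) :
    ((pairList x X).map f).prod = ∏ j, f (x j, X j) := by
  simp [pairList, List.map_ofFn, List.prod_ofFn, Function.comp_def]

theorem length_pairList {k : ℕ} (x X : Fin k → ℝ) : (pairList x X).length = k := by
  simp [pairList]

theorem mem_pairList {k : ℕ} {x X : Fin k → ℝ} {p : ℂ × ℝ} :
    p ∈ pairList x X ↔ ∃ j, ((x j : ℂ), X j) = p := by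
  simp [pairList, List.mem_ofFn]

section
variable {n₁ n₂ n₃ n₄ : ℕ} (a₁ b : Fin n₁ → ℝ) (a₂ c d : Fin n₂ → ℝ) (a₃ o r : Fin n₃ → ℝ)
  (a₄ v w : Fin n₄ → ℝ)

theorem take_epLower : (epLower a₁ b a₂ c a₃ o a₄ w).take (n₁ + n₂ + n₃) =
    pairList b a₁ ++ pairList c a₂ ++ pairList o a₃ :=
  List.take_left' (by simp [length_pairList, add_assoc])

theorem drop_epLower : (epLower a₁ b a₂ c a₃ o a₄ w).drop (n₁ + n₂ + n₃) =
    pairList (fun j => 1 - w j) a₄ :=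
  List.drop_left' (by simp [length_pairList, add_assoc])

theorem take_epUpper : (epUpper a₂ d a₃ r a₄ v).take (n₃ + n₄) =
    pairList (fun j => 1 - r j) a₃ ++ pairList (fun j => 1 - v j) a₄ :=
  List.take_left' (by simp [length_pairList])

theorem drop_epUpper : (epUpper a₂ d a₃ r a₄ v).drop (n₃ + n₄) = pairList d a₂ :=
  List.drop_left' (by simp [length_pairList])

/-- The reflection `1 - α` turns `1 - r`, `1 - v`, `1 - w` back into `r`, `v`, `w` with negated
slope, and equal slopes let `c` pair with `d` and `v` with `w` in beta quotients. -/
theorem foxXi_ep (s : ℂ) :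
    foxXi (n₁ + n₂ + n₃) (n₃ + n₄) (epUpper a₂ d a₃ r a₄ v) (epLower a₁ b a₂ c a₃ o a₄ w) s =
      (∏ j, Complex.Gamma (b j + a₁ j * s)) * (∏ j, Complex.Gamma (o j + a₃ j * s)) *
        (∏ j, Complex.Gamma (r j + (-a₃ j : ℝ) * s)) *
        (∏ j, Complex.Gamma (c j + a₂ j * s) / Complex.Gamma (d j + a₂ j * s)) *
        ∏ j, Complex.Gamma (v j + (-a₄ j : ℝ) * s) / Complex.Gamma (w j + (-a₄ j : ℝ) * s) := by
  have e : ∀ x y : ℝ, (1 - ((1 - x : ℝ) : ℂ) - y * s) = x + (-y : ℝ) * s := fun x y => by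
    push_cast; ring
  rw [foxXi, take_epLower, drop_epLower, take_epUpper, drop_epUpper]
  simp only [List.map_append, List.prod_append, prod_map_pairList, e, Finset.prod_div_distrib]
  ring

/-- As the slopes are positive, the pole `l = 0` of each family is the one nearest the line.
Separation thus says that every numerator Gamma has an argument of positive real part, exactly where
the Mellin integrals converge. -/
theorem foxSeparates_ep_iff (ha₁ : ∀ j, 0 < a₁ j) (ha₂ : ∀ j, 0 < a₂ j) (ha₃ : ∀ j, 0 < a₃ j)
    (ha₄ : ∀ j, 0 < a₄ j) (γ : ℝ) :
    FoxSeparates (n₁ + n₂ + n₃) (n₃ + n₄) (epUpper a₂ d a₃ r a₄ v)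
        (epLower a₁ b a₂ c a₃ o a₄ w) γ ↔
      (∀ j, 0 < b j + a₁ j * γ) ∧ (∀ j, 0 < c j + a₂ j * γ) ∧ (∀ j, 0 < o j + a₃ j * γ) ∧
        (∀ j, 0 < r j + -a₃ j * γ) ∧ ∀ j, 0 < v j + -a₄ j * γ := by
  have left : ∀ x y : ℝ, 0 < y →
      ((∀ l : ℕ, (-((x : ℂ) + l) / (y : ℂ)).re < γ) ↔ 0 < x + y * γ) := by
    intro x y hy
    have hre : ∀ l : ℕ, (-((x : ℂ) + l) / (y : ℂ)).re = -(x + l) / y := fun l => by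
      rw [Complex.div_ofReal_re]; simp
    simp only [hre, div_lt_iff₀ hy]
    refine ⟨fun h => by have := h 0; simp at this; linarith, fun h l => ?_⟩
    have : (0 : ℝ) ≤ l := Nat.cast_nonneg l
    linarith
  have right : ∀ x y : ℝ, 0 < y →
      ((∀ l : ℕ, γ < ((1 - ((1 - x : ℝ) : ℂ) + l) / (y : ℂ)).re) ↔ 0 < x + -y * γ) := by
    intro x y hy
    have hre : ∀ l : ℕ, ((1 - ((1 - x : ℝ) : ℂ) + l) / (y : ℂ)).re = (x + l) / y := fun l => by
      rw [Complex.div_ofReal_re]; simp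
    simp only [hre, lt_div_iff₀ hy]
    refine ⟨fun h => by have := h 0; simp at this; linarith, fun h l => ?_⟩
    have : (0 : ℝ) ≤ l := Nat.cast_nonneg l
    linarith
  rw [FoxSeparates, take_epLower, take_epUpper]
  simp only [List.mem_append, mem_pairList, or_imp, forall_and, forall_exists_index,
    forall_apply_eq_imp_iff, left _ _ (ha₁ _), left _ _ (ha₂ _), left _ _ (ha₃ _),
    right _ _ (ha₃ _), right _ _ (ha₄ _), and_assoc]

end

/-! ### Assembly of the factors -/

theorem hasPosMellinInverse_foxXi_ep {n₁ n₂ n₃ n₄ : ℕ}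
    (a₁ b : Fin n₁ → ℝ) (a₂ c d : Fin n₂ → ℝ) (a₃ o r : Fin n₃ → ℝ) (a₄ v w : Fin n₄ → ℝ)
    (hn : 1 ≤ n₁ ∨ 1 ≤ n₃) {S : Set ℝ} (hS : S.Nonempty)
    (ha₁ : ∀ j, 0 < a₁ j) (ha₃ : ∀ j, 0 < a₃ j) (hcd : ∀ j, c j < d j) (hvw : ∀ j, v j < w j)
    (hb : ∀ γ ∈ S, ∀ j, 0 < b j + a₁ j * γ) (hc : ∀ γ ∈ S, ∀ j, 0 < c j + a₂ j * γ)
    (ho : ∀ γ ∈ S, ∀ j, 0 < o j + a₃ j * γ) (hr : ∀ γ ∈ S, ∀ j, 0 < r j + -a₃ j * γ)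
    (hv : ∀ γ ∈ S, ∀ j, 0 < v j + -a₄ j * γ) :
    HasPosMellinInverse S (foxXi (n₁ + n₂ + n₃) (n₃ + n₄) (epUpper a₂ d a₃ r a₄ v)
      (epLower a₁ b a₂ c a₃ o a₄ w)) := by
  have hb' : ∀ j, IsPosMellinTransform S fun s => Complex.Gamma (b j + a₁ j * s) :=
    fun j => isPosMellinTransform_Gamma fun γ hγ => hb γ hγ j
  have ho' : ∀ j, IsPosMellinTransform S fun s => Complex.Gamma (o j + a₃ j * s) :=
    fun j => isPosMellinTransform_Gamma fun γ hγ => ho γ hγ j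
  suffices h : HasPosMellinInverse S fun s =>
      (∏ j, Complex.Gamma (b j + a₁ j * s)) * ∏ j, Complex.Gamma (o j + a₃ j * s) by
    rw [funext (foxXi_ep a₁ b a₂ c d a₃ o r a₄ v w)]
    refine ((h.mul_prod hS _ fun j _ => ?_).mul_prod hS _ fun j _ => ?_).mul_prod hS _ fun j _ => ?_
    · exact isPosMellinTransform_Gamma fun γ hγ => hr γ hγ j
    · exact isPosMellinTransform_Gamma_div_Gamma (hcd j) fun γ hγ => hc γ hγ j
    · exact isPosMellinTransform_Gamma_div_Gamma (hvw j) fun γ hγ => hv γ hγ j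
  rcases hn with hn | hn
  · let i : Fin n₁ := ⟨0, hn⟩
    have := ((hasPosMellinInverse_Gamma (ha₁ i) fun γ hγ => hb γ hγ i).mul_prod hS
      (Finset.univ.erase i) fun j _ => hb' j).mul_prod hS Finset.univ fun j _ => ho' j
    refine cast (congrArg _ (funext fun s => ?_)) this
    rw [Finset.mul_prod_erase _ (fun j => Complex.Gamma (b j + a₁ j * s)) (Finset.mem_univ i)]
  · let i : Fin n₃ := ⟨0, hn⟩
    have := ((hasPosMellinInverse_Gamma (ha₃ i) fun γ hγ => ho γ hγ i).mul_prod hS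
      (Finset.univ.erase i) fun j _ => ho' j).mul_prod hS Finset.univ fun j _ => hb' j
    refine cast (congrArg _ (funext fun s => ?_)) this
    rw [Finset.mul_prod_erase _ (fun j => Complex.Gamma (o j + a₃ j * s)) (Finset.mem_univ i),
      mul_comm]

/-- Any small `γ > 0` works: `b`, `c`, `o` may be zero, so `γ` must be positive, while `r`, `v` are
strictly positive and leave room on the right. -/
theorem exists_foxSeparates_ep {n₁ n₂ n₃ n₄ : ℕ}
    (a₁ b : Fin n₁ → ℝ) (a₂ c : Fin n₂ → ℝ) (a₃ o r : Fin n₃ → ℝ) (a₄ v : Fin n₄ → ℝ)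
    (h₁ : ∀ j, 0 < a₁ j ∧ 0 ≤ b j) (h₂ : ∀ j, 0 < a₂ j ∧ 0 ≤ c j)
    (h₃ : ∀ j, 0 < a₃ j ∧ 0 < r j ∧ 0 ≤ o j) (h₄ : ∀ j, 0 < v j) :
    ∃ γ : ℝ, (∀ j, 0 < b j + a₁ j * γ) ∧ (∀ j, 0 < c j + a₂ j * γ) ∧
      (∀ j, 0 < o j + a₃ j * γ) ∧ (∀ j, 0 < r j + -a₃ j * γ) ∧ ∀ j, 0 < v j + -a₄ j * γ := by
  have small : ∀ x y : ℝ, 0 < x → ∀ᶠ γ : ℝ in nhdsWithin 0 (Set.Ioi 0), 0 < x + -y * γ := by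
    intro x y hx
    have : ContinuousAt (fun γ : ℝ => x + -y * γ) 0 := by fun_prop
    exact (this.eventually (lt_mem_nhds (by simpa using hx))).filter_mono nhdsWithin_le_nhds
  obtain ⟨γ, hγ, hr, hv⟩ := (Filter.Eventually.and (self_mem_nhdsWithin (s := Set.Ioi (0 : ℝ)))
    ((Filter.eventually_all.2 fun j => small (r j) (a₃ j) (h₃ j).2.1).and
      (Filter.eventually_all.2 fun j => small (v j) (a₄ j) (h₄ j)))).exists
  have hγ : 0 < γ := hγ
  exact ⟨γ, fun j => add_pos_of_nonneg_of_pos (h₁ j).2 (mul_pos (h₁ j).1 hγ),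
    fun j => add_pos_of_nonneg_of_pos (h₂ j).2 (mul_pos (h₂ j).1 hγ),
    fun j => add_pos_of_nonneg_of_pos (h₃ j).2.2 (mul_pos (h₃ j).1 hγ), hr, hv⟩

theorem theorem2 (n₁ n₂ n₃ n₄ : ℕ)
    (a₁ b : Fin n₁ → ℝ) (a₂ c d : Fin n₂ → ℝ) (a₃ o r : Fin n₃ → ℝ) (a₄ v w : Fin n₄ → ℝ)
    (hn : 1 ≤ n₁ ∨ 1 ≤ n₃)
    (h₁ : ∀ j, 0 < a₁ j ∧ 0 ≤ b j)
    (h₂ : ∀ j, 0 < a₂ j ∧ 0 ≤ c j ∧ c j + 1 ≤ d j)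
    (h₃ : ∀ j, 0 < a₃ j ∧ 0 < r j ∧ 0 ≤ o j)
    (h₄ : ∀ j, 0 < a₄ j ∧ 0 < v j ∧ v j + 1 ≤ w j)
    (hpoles : FoxPolesDisjoint (n₁ + n₂ + n₃) (n₃ + n₄)
      (epUpper a₂ d a₃ r a₄ v) (epLower a₁ b a₂ c a₃ o a₄ w)) :
    (∃ γ : ℝ, FoxSeparates (n₁ + n₂ + n₃) (n₃ + n₄)
      (epUpper a₂ d a₃ r a₄ v) (epLower a₁ b a₂ c a₃ o a₄ w) γ) ∧
    ∀ t : ℝ, 0 < t → ∃ h : ℝ, 0 < h ∧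
      ∀ γ : ℝ, FoxSeparates (n₁ + n₂ + n₃) (n₃ + n₄)
          (epUpper a₂ d a₃ r a₄ v) (epLower a₁ b a₂ c a₃ o a₄ w) γ →
        FoxHConverges (n₁ + n₂ + n₃) (n₃ + n₄)
            (epUpper a₂ d a₃ r a₄ v) (epLower a₁ b a₂ c a₃ o a₄ w) γ t ∧
          foxH (n₁ + n₂ + n₃) (n₃ + n₄)
            (epUpper a₂ d a₃ r a₄ v) (epLower a₁ b a₂ c a₃ o a₄ w) γ t = (h : ℂ) := by

  have hsep := foxSeparates_ep_iff a₁ b a₂ c d a₃ o r a₄ v w (fun j => (h₁ j).1)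
    (fun j => (h₂ j).1) (fun j => (h₃ j).1) fun j => (h₄ j).1
  obtain ⟨γ₀, hγ₀⟩ := exists_foxSeparates_ep a₁ b a₂ c a₃ o r a₄ v h₁
    (fun j => ⟨(h₂ j).1, (h₂ j).2.1⟩) h₃ fun j => (h₄ j).2.1
  refine ⟨⟨γ₀, (hsep γ₀).2 hγ₀⟩, fun t ht => ?_⟩
  -- Taking for `S` the set of all separating abscissas yields one `h` valid on every such line.
  obtain ⟨h, hh⟩ := hasPosMellinInverse_foxXi_ep a₁ b a₂ c d a₃ o r a₄ v w hn
    (S := {γ | FoxSeparates (n₁ + n₂ + n₃) (n₃ + n₄)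
      (epUpper a₂ d a₃ r a₄ v) (epLower a₁ b a₂ c a₃ o a₄ w) γ}) ⟨γ₀, (hsep γ₀).2 hγ₀⟩
    (fun j => (h₁ j).1) (fun j => (h₃ j).1) (fun j => by linarith [(h₂ j).2.2])
    (fun j => by linarith [(h₄ j).2.2]) (fun γ hγ => ((hsep γ).1 hγ).1)
    (fun γ hγ => ((hsep γ).1 hγ).2.1) (fun γ hγ => ((hsep γ).1 hγ).2.2.1)
    (fun γ hγ => ((hsep γ).1 hγ).2.2.2.1) (fun γ hγ => ((hsep γ).1 hγ).2.2.2.2)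
  refine ⟨h t, (hh t ht).1, fun γ hγ => ?_⟩
  obtain ⟨hint, heq⟩ := (hh t ht).2 γ hγ
  refine ⟨hint, ?_⟩
  have hπ : (Real.pi : ℂ) ≠ 0 := by exact_mod_cast Real.pi_ne_zero
  rw [foxH, integral_mul_const]
  simp only [foxIntegrand]
  rw [heq]
  field_simp
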